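/- Call a subset $C\subseteq\mathbb{R}^2$ an $x$-monotone curve if it is the image of an interval under a continuous map and meets every vertical line in at most one point. Let $A$ be a finite set of $x$-monotone curves, each of which projects onto the whole $x$-axis, such that any two distinct curves of $A$ have only finitely many points in common. The dual graph $G$ of the arrangement has as vertices the regions of $A$, that is, the connected components of $\mathbb{R}^2\setminus\bigcup A$; two distinct regions are adjacent if some edge of the arrangement (a connected component of $\bigcup A$ minus the points lying on at least two of the curves) is contained in the boundary of both. For a region $R$ let $\ell(R)$ be the number of curves of $A$ that pass above $R$. Then the set of points lying strictly above all curves of $A$ is a region $T$ (the topmost region), and $\ell$ is a planar breadth-first layering of $G$ starting at $T$: 1. $G$ is connected, and $\ell(R)$ is the distance from $T$ to $R$ in $G$ for every region $R$; 2. $G$ has a leveled planar drawing with layers given by $\ell$: the regions can be represented by distinct points of the plane, with the point of $R$ on the horizontal line $y=\ell(R)$, so that every edge of $G$ joins points on consecutive lines and, when all edges are drawn as straight segments, no segment contains a vertex other than its endpoints and two distinct segments meet at most in a common endpoint. -/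

import Mathlib

namespace MonotoneArrangement

/-- An `x`-monotone curve in the plane: a continuous image of an interval of the real line that
meets every vertical line in at most one point. -/
def IsXMonotoneCurve (C : Set (ℝ × ℝ)) : Prop :=
  (∃ (I : Set ℝ) (γ : ℝ → ℝ × ℝ), I.OrdConnected ∧ ContinuousOn γ I ∧ C = γ '' I) ∧
    ∀ p ∈ C, ∀ q ∈ C, p.1 = q.1 → p = q

/-- The regions of the arrangement: the connected components of the complement of the union of
the curves. They are the vertices of the dual graph. -/
def Region (A : Set (Set (ℝ × ℝ))) : Type :=
  {R : Set (ℝ × ℝ) // ∃ p ∈ (⋃₀ A)ᶜ, R = connectedComponentIn (⋃₀ A)ᶜ p}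

/-- The intersection points of the arrangement: points that lie on two distinct curves. -/
def crossingPoints (A : Set (Set (ℝ × ℝ))) : Set (ℝ × ℝ) :=
  {p | ∃ C ∈ A, ∃ D ∈ A, C ≠ D ∧ p ∈ C ∧ p ∈ D}

/-- `E` is an edge of the arrangement: a connected component of the union of the curves with all
intersection points removed. -/
def IsEdge (A : Set (Set (ℝ × ℝ))) (E : Set (ℝ × ℝ)) : Prop :=
  ∃ p ∈ ⋃₀ A \ crossingPoints A, E = connectedComponentIn (⋃₀ A \ crossingPoints A) p

/-- The dual graph of the arrangement: two distinct regions are adjacent when some edge of the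
arrangement lies on the boundary of both. -/
def dualGraph (A : Set (Set (ℝ × ℝ))) : SimpleGraph (Region A) where
  Adj R S := R ≠ S ∧ ∃ E, IsEdge A E ∧ E ⊆ frontier R.1 ∧ E ⊆ frontier S.1
  symm := ⟨fun _ _ h => ⟨h.1.symm, h.2.imp fun _ hE => ⟨hE.1, hE.2.2, hE.2.1⟩⟩⟩
  loopless := ⟨fun _ h => h.1 rfl⟩

/-- The curve `C` passes above the set `R`: every point of `R` has a point of `C` strictly above
it on the same vertical line. -/
def PassesAbove (C R : Set (ℝ × ℝ)) : Prop :=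
  ∀ p ∈ R, ∃ q ∈ C, q.1 = p.1 ∧ p.2 < q.2

/-- The number of curves of the arrangement that pass above a region. -/
noncomputable def curvesAbove (A : Set (Set (ℝ × ℝ))) (R : Region A) : ℕ :=
  {C ∈ A | PassesAbove C R.1}.ncard

/-- The part of the plane that lies strictly above all curves of the arrangement. -/
def aboveAll (A : Set (Set (ℝ × ℝ))) : Set (ℝ × ℝ) :=
  {p | ∀ C ∈ A, ∀ q ∈ C, q.1 = p.1 → q.2 < p.2}

/-- `layer` is the breadth first layering of `G` that starts at `r`: every vertex is reachable
from `r`, and its layer number is its distance from `r`. -/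
def IsBreadthFirstLayering {V : Type*} (G : SimpleGraph V) (r : V) (layer : V → ℕ) : Prop :=
  ∀ v, G.Reachable r v ∧ G.dist r v = layer v

/-- `layer` is a planar layering of `G`: there is a leveled planar drawing of `G` with these
layers. Layer `k` is drawn on the horizontal line at height `k`, distinct vertices are
distinct points, each edge joins two consecutive layers and is drawn as a straight segment, an
edge contains no vertex other than its endpoints, and two distinct edges have no common point
other than a common endpoint. -/
def IsPlanarLayering {V : Type*} (G : SimpleGraph V) (layer : V → ℕ) : Prop :=
  ∃ pos : V → ℝ × ℝ,
    (∀ v, (pos v).2 = layer v) ∧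
    Function.Injective pos ∧
    (∀ u v, G.Adj u v → layer v = layer u + 1 ∨ layer u = layer v + 1) ∧
    (∀ u v w, G.Adj u v → pos w ∈ segment ℝ (pos u) (pos v) → w = u ∨ w = v) ∧
    (∀ u v u' v', G.Adj u v → G.Adj u' v' → s(u, v) ≠ s(u', v') →
      ∀ p ∈ segment ℝ (pos u) (pos v) ∩ segment ℝ (pos u') (pos v'),
        ∃ w, p = pos w ∧ (w = u ∨ w = v) ∧ (w = u' ∨ w = v'))

end MonotoneArrangement

namespace MonotoneArrangement

open Set Topology

/-! ### Layerings of graphs -/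

section Graph

variable {V : Type*} {G : SimpleGraph V} {layer : V → ℕ}

/-! Each curve is the graph of a continuous function, and a region, being connected and off the
curves, lies on one side of each. So its layer number can be read off at any of its points. On a
vertical line, two points with equally many curves above them have no curve between them; hence
regions of one layer over a common abscissa coincide (`Region.eq_of_curvesAbove_eq`). The regions of
a layer thus project to disjoint intervals, ordered from left to right.

Near an edge point only one curve is present, so adjacent regions are its two sides: their layers
are consecutive and their projections meet (`dualGraph_adj`). Place each region at any abscissa of
its projection. Two crossing segments would need opposite orders in the two layers, which the common
abscissas of adjacent regions forbid (`isPlanarLayering_of_intervals`).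

For distances, each edge changes the layer by one, and going straight up from a region other than
the topmost, along a line through no crossing, enters a neighbour one layer closer
(`exists_adj_of_curvesAbove_pos`). -/

/-- A function that increases by at most one along edges grows by at most the length of a walk. -/
lemma le_add_length_of_walk (hstep : ∀ u v, G.Adj u v → layer v ≤ layer u + 1) {u v : V}
    (p : G.Walk u v) : layer v ≤ layer u + p.length := by
  induction p with
  | nil => simp
  | cons h p ih =>
    have := hstep _ _ h
    simp only [SimpleGraph.Walk.length_cons]
    omega

/-- A layering in which every vertex outside layer zero has a neighbour in the previous layer,
and adjacent vertices differ by at most one layer, is the breadth first layering. -/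
lemma isBreadthFirstLayering_of_step {r : V} (hr : layer r = 0) (huniq : ∀ v, layer v = 0 → v = r)
    (hstep : ∀ u v, G.Adj u v → layer v ≤ layer u + 1)
    (hprev : ∀ v, 0 < layer v → ∃ u, G.Adj u v ∧ layer v = layer u + 1) :
    IsBreadthFirstLayering G r layer := by
  have key : ∀ n v, layer v = n → ∃ p : G.Walk r v, p.length = n := by
    intro n
    induction n with
    | zero =>
      intro v hv
      obtain rfl := huniq v hv
      exact ⟨.nil, rfl⟩
    | succ n ih =>
      intro v hv
      obtain ⟨u, huv, hl⟩ := hprev v (by omega)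
      obtain ⟨p, hp⟩ := ih u (by omega)
      exact ⟨p.concat huv, by simp [hp]⟩
  intro v
  obtain ⟨p, hp⟩ := key _ v rfl
  refine ⟨p.reachable, le_antisymm (hp ▸ SimpleGraph.dist_le p) ?_⟩
  obtain ⟨q, hq⟩ := p.reachable.exists_walk_length_eq_dist
  have := le_add_length_of_walk hstep q
  omega

/-- If the vertices are represented by order-connected sets of reals, disjoint within each layer,
such that adjacent vertices lie in consecutive layers and have sets that meet, then the layering
is planar. -/
lemma isPlanarLayering_of_intervals (I : V → Set ℝ) (x : V → ℝ) (hI : ∀ v, (I v).OrdConnected)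
    (hx : ∀ v, x v ∈ I v)
    (hdisj : ∀ u v, layer u = layer v → (I u ∩ I v).Nonempty → u = v)
    (hlayer : ∀ u v, G.Adj u v → layer v = layer u + 1 ∨ layer u = layer v + 1)
    (hmeet : ∀ u v, G.Adj u v → (I u ∩ I v).Nonempty) :
    IsPlanarLayering G layer := by
  have hlt : ∀ u v, layer u = layer v → u ≠ v → x u < x v →
      ∀ a ∈ I u, ∀ b ∈ I v, a < b := by
    intro u v hl hne hxy a ha b hb
    by_contra hab
    apply hne
    apply hdisj u v hl
    rcases le_total (x v) a with h | h
    · exact ⟨x v, (hI u).out (hx u) ha ⟨hxy.le, h⟩, hx v⟩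
    · exact ⟨a, ha, (hI v).out hb (hx v) ⟨not_lt.1 hab, h⟩⟩
  let pos : V → ℝ × ℝ := fun v => (x v, layer v)
  have hinj : Function.Injective pos := by
    intro u v huv
    have h1 : x u = x v := congrArg Prod.fst huv
    have h2 : (layer u : ℝ) = layer v := congrArg Prod.snd huv
    exact hdisj u v (by exact_mod_cast h2) ⟨x u, hx u, h1 ▸ hx v⟩
  have hseg : ∀ u v, layer v = layer u + 1 → ∀ p ∈ segment ℝ (pos u) (pos v),
      ∃ t : ℝ, 0 ≤ t ∧ t ≤ 1 ∧ p = ((1 - t) * x u + t * x v, (layer u : ℝ) + t) := by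
    rintro u v hl p ⟨a, t, ha, ht, hat, rfl⟩
    refine ⟨t, ht, by linarith, ?_⟩
    obtain rfl : a = 1 - t := by linarith
    ext
    · simp [pos]
    · simp [pos, hl]
      ring
  have hvert : ∀ u v w, layer v = layer u + 1 → pos w ∈ segment ℝ (pos u) (pos v) →
      w = u ∨ w = v := by
    intro u v w hl hw
    obtain ⟨t, ht0, ht1, ht⟩ := hseg u v hl _ hw
    have h1 : x w = (1 - t) * x u + t * x v := congrArg Prod.fst ht
    have h2 : (layer w : ℝ) = layer u + t := congrArg Prod.snd ht
    have h3 : layer u ≤ layer w := by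
      have : (layer u : ℝ) ≤ layer w := by linarith
      exact_mod_cast this
    have h4 : layer w ≤ layer u + 1 := by
      have : (layer w : ℝ) ≤ layer u + 1 := by linarith
      exact_mod_cast this
    rcases (show layer w = layer u ∨ layer w = layer u + 1 by omega) with h | h
    · obtain rfl : t = 0 := by rw [h] at h2; linarith
      left
      apply hinj
      ext <;> simp [pos, h, h1]
    · obtain rfl : t = 1 := by rw [h] at h2; push_cast at h2; linarith
      right
      apply hinj
      ext <;> simp [pos, h, h1, hl]
  have hcross : ∀ u v u' v', G.Adj u v → G.Adj u' v' → layer v = layer u + 1 →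
      layer v' = layer u' + 1 → s(u, v) ≠ s(u', v') →
      ∀ p ∈ segment ℝ (pos u) (pos v) ∩ segment ℝ (pos u') (pos v'),
        ∃ w, p = pos w ∧ (w = u ∨ w = v) ∧ (w = u' ∨ w = v') := by
    rintro u v u' v' huv huv' hl hl' hne p ⟨hp, hp'⟩
    -- A vertex on a segment is an endpoint of it by `hvert`, so it is enough that the common point
    -- is some vertex.
    suffices ∃ w, p = pos w by
      obtain ⟨w, rfl⟩ := this
      exact ⟨w, rfl, hvert u v w hl hp, hvert u' v' w hl' hp'⟩
    obtain ⟨t, ht0, ht1, ht⟩ := hseg u v hl p hp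
    obtain ⟨t', ht0', ht1', ht'⟩ := hseg u' v' hl' p hp'
    have hfst : (1 - t) * x u + t * x v = (1 - t') * x u' + t' * x v' :=
      congrArg Prod.fst (ht.symm.trans ht')
    have hsnd : (layer u : ℝ) + t = layer u' + t' := congrArg Prod.snd (ht.symm.trans ht')
    have hend0 : t = 0 → ∃ w, p = pos w := by
      rintro rfl
      exact ⟨u, by simp [ht, pos]⟩
    have hend1 : t = 1 → ∃ w, p = pos w := by
      rintro rfl
      exact ⟨v, by simp [ht, pos, hl]⟩
    -- Segments from different slabs can share only a point at integer height, which is an endpoint.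
    rcases lt_trichotomy (layer u) (layer u') with h | h | h
    · have : (layer u : ℝ) + 1 ≤ layer u' := by exact_mod_cast h
      exact hend1 (by linarith)
    · obtain rfl : t = t' := by rw [h] at hsnd; linarith
      by_contra hno
      have ht0 : 0 < t := lt_of_le_of_ne ht0 fun h0 => hno (hend0 h0.symm)
      have ht1 : t < 1 := lt_of_le_of_ne ht1 fun h0 => hno (hend1 h0)
      have hu : u ≠ u' := by
        rintro rfl
        have : t * x v = t * x v' := by linarith
        have hxx := mul_left_cancel₀ ht0.ne' this
        have : v = v' := hinj (by ext <;> simp [pos, hxx, hl, hl'])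
        exact hne (by rw [this])
      have hv : v ≠ v' := by
        rintro rfl
        have : (1 - t) * x u = (1 - t) * x u' := by linarith
        have hxx := mul_left_cancel₀ (sub_pos.2 ht1).ne' this
        have : u = u' := hinj (by ext <;> simp [pos, hxx, h])
        exact hne (by rw [this])
      have hlv : layer v = layer v' := by omega
      have hxu : x u ≠ x u' := fun e => hu (hinj (by ext <;> simp [pos, e, h]))
      have hxv : x v ≠ x v' := fun e => hv (hinj (by ext <;> simp [pos, e, hlv]))
      obtain ⟨a, hau, hav⟩ := hmeet u v huv
      obtain ⟨b, hbu, hbv⟩ := hmeet u' v' huv'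
      -- With equal orders at both ends, the abscissas differ at every intermediate height. With
      -- opposite orders, disjointness in one layer gives `a < b` and in the other `b < a`.
      rcases hxu.lt_or_gt with h1 | h1 <;> rcases hxv.lt_or_gt with h2 | h2
      · nlinarith
      · exact lt_asymm (hlt _ _ h hu h1 a hau b hbu) (hlt _ _ hlv.symm hv.symm h2 b hbv a hav)
      · exact lt_asymm (hlt _ _ hlv hv h2 a hav b hbv) (hlt _ _ h.symm hu.symm h1 b hbu a hau)
      · nlinarith
    · have : (layer u' : ℝ) + 1 ≤ layer u := by exact_mod_cast h
      exact hend0 (by linarith)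
  refine ⟨pos, fun _ => rfl, hinj, hlayer, ?_, ?_⟩
  · intro u v w huv hw
    rcases hlayer u v huv with h | h
    · exact hvert u v w h hw
    · exact (hvert v u w h (segment_symm ℝ (pos u) (pos v) ▸ hw)).symm
  · rintro u v u' v' huv huv' hne p ⟨hp, hp'⟩
    rcases hlayer u v huv with h | h <;> rcases hlayer u' v' huv' with h' | h'
    · exact hcross u v u' v' huv huv' h h' hne p ⟨hp, hp'⟩
    · rw [segment_symm] at hp'
      obtain ⟨w, h1, h2, h3⟩ := hcross u v v' u' huv huv'.symm h h'
        (by rwa [Sym2.eq_swap (a := v')]) p ⟨hp, hp'⟩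
      exact ⟨w, h1, h2, h3.symm⟩
    · rw [segment_symm] at hp
      obtain ⟨w, h1, h2, h3⟩ := hcross v u u' v' huv.symm huv' h h'
        (by rwa [Sym2.eq_swap (a := v)]) p ⟨hp, hp'⟩
      exact ⟨w, h1, h2.symm, h3⟩
    · rw [segment_symm] at hp hp'
      obtain ⟨w, h1, h2, h3⟩ := hcross v u v' u' huv.symm huv'.symm h h'
        (by rwa [Sym2.eq_swap (a := v), Sym2.eq_swap (a := v')]) p ⟨hp, hp'⟩
      exact ⟨w, h1, h2.symm, h3.symm⟩

end Graph

/-! ### Curves as graphs of continuous functions -/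

/-- An `x`-monotone curve that projects onto the whole axis is the graph of a continuous
function. -/
lemma IsXMonotoneCurve.exists_continuous {C : Set (ℝ × ℝ)} (hC : IsXMonotoneCurve C)
    (hcover : Prod.fst '' C = univ) :
    ∃ f : ℝ → ℝ, Continuous f ∧ ∀ p, p ∈ C ↔ p.2 = f p.1 := by
  obtain ⟨⟨I, γ, hI, hγ, rfl⟩, hinj⟩ := hC
  have hex : ∀ x, ∃ y, (x, y) ∈ γ '' I := by
    intro x
    obtain ⟨⟨_, y⟩, hp, rfl⟩ := hcover.symm ▸ mem_univ x
    exact ⟨y, hp⟩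
  choose f hf using hex
  have hmem : ∀ p, p ∈ γ '' I ↔ p.2 = f p.1 := by
    intro p
    constructor
    · intro hp
      exact congrArg Prod.snd (hinj p hp _ (hf p.1) rfl)
    · intro hp
      have := hf p.1
      rwa [← hp] at this
  refine ⟨f, ?_, hmem⟩
  rw [continuous_iff_continuousAt]
  intro x
  suffices ContinuousOn f (Icc (x - 1) (x + 1)) from
    this.continuousAt (Icc_mem_nhds (by linarith) (by linarith))
  obtain ⟨s, hs, hsx⟩ := hf (x - 1)
  obtain ⟨t, ht, htx⟩ := hf (x + 1)
  have hst : uIcc s t ⊆ I := hI.uIcc_subset hs ht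
  have hK : IsCompact (γ '' uIcc s t) := isCompact_uIcc.image_of_continuousOn (hγ.mono hst)
  -- By the intermediate value theorem a compact arc of the curve covers the whole window. There,
  -- preimages of closed sets under `f` are projections of compact sets, hence closed.
  have hsurj : Icc (x - 1) (x + 1) ⊆ (fun r => (γ r).1) '' uIcc s t := by
    have := intermediate_value_uIcc (f := fun r => (γ r).1) (a := s) (b := t)
      (continuous_fst.comp_continuousOn (hγ.mono hst))
    simp only [hsx, htx] at this
    rwa [uIcc_of_le (by linarith)] at this
  rw [continuousOn_iff_isClosed]
  intro Z hZ
  refine ⟨Prod.fst '' (γ '' uIcc s t ∩ Prod.snd ⁻¹' Z),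
    ((hK.inter_right (hZ.preimage continuous_snd)).image continuous_fst).isClosed, ?_⟩
  ext y
  constructor
  · rintro ⟨hyZ, hy⟩
    obtain ⟨r, hr, rfl⟩ := hsurj hy
    refine ⟨⟨γ r, ⟨⟨r, hr, rfl⟩, ?_⟩, rfl⟩, hy⟩
    have := (hmem (γ r)).1 ⟨r, hst hr, rfl⟩
    rwa [mem_preimage, this]
  · rintro ⟨⟨_, ⟨⟨r, hr, rfl⟩, hZr⟩, rfl⟩, hy⟩
    refine ⟨?_, hy⟩
    have := (hmem (γ r)).1 ⟨r, hst hr, rfl⟩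
    rwa [mem_preimage, ← this]

/-- The members of `A` are the graphs of the continuous functions `F C`. -/
def IsGraphFamily (A : Set (Set (ℝ × ℝ))) (F : Set (ℝ × ℝ) → ℝ → ℝ) : Prop :=
  ∀ C ∈ A, Continuous (F C) ∧ ∀ p, p ∈ C ↔ p.2 = F C p.1

/-- The set of curves that are above a point. -/
def curvesOver (A : Set (Set (ℝ × ℝ))) (F : Set (ℝ × ℝ) → ℝ → ℝ) (p : ℝ × ℝ) :
    Set (Set (ℝ × ℝ)) :=
  {C ∈ A | p.2 < F C p.1}

section Arrangement

variable {A : Set (Set (ℝ × ℝ))} {F : Set (ℝ × ℝ) → ℝ → ℝ}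

lemma IsGraphFamily.mem_compl_iff (hF : IsGraphFamily A F) {p : ℝ × ℝ} :
    p ∈ (⋃₀ A)ᶜ ↔ ∀ C ∈ A, p.2 ≠ F C p.1 := by
  refine ⟨fun h C hC hp => h ⟨C, hC, ((hF C hC).2 p).2 hp⟩, ?_⟩
  rintro h ⟨C, hC, hp⟩
  exact h C hC (((hF C hC).2 p).1 hp)

lemma IsGraphFamily.isOpen_compl (hF : IsGraphFamily A F) (hA : A.Finite) :
    IsOpen (⋃₀ A)ᶜ := by
  rw [isOpen_compl_iff, sUnion_eq_biUnion]
  refine hA.isClosed_biUnion fun C hC => ?_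
  have : C = {p | p.2 = F C p.1} := ext fun p => (hF C hC).2 p
  rw [this]
  exact isClosed_eq continuous_snd ((hF C hC).1.comp continuous_fst)

/-- A connected set that misses a graph and has a point below it lies below it. -/
lemma lt_of_isPreconnected {f : ℝ → ℝ} (hf : Continuous f) {S : Set (ℝ × ℝ)}
    (hS : IsPreconnected S) (hmiss : ∀ p ∈ S, p.2 ≠ f p.1) {p q : ℝ × ℝ} (hp : p ∈ S)
    (hq : q ∈ S) (h : p.2 < f p.1) : q.2 < f q.1 := by
  by_contra hlt
  obtain ⟨r, hr, hr'⟩ := hS.intermediate_value₂ hp hq continuous_snd.continuousOn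
    (hf.comp continuous_fst).continuousOn h.le (not_lt.1 hlt)
  exact hmiss r hr hr'

/-! ### Regions and their layer numbers -/

namespace Region

lemma subset_compl (R : Region A) : R.1 ⊆ (⋃₀ A)ᶜ := by
  obtain ⟨_, p, hp, rfl⟩ := R
  exact connectedComponentIn_subset _ _

lemma isPreconnected (R : Region A) : IsPreconnected R.1 := by
  obtain ⟨_, p, hp, rfl⟩ := R
  exact isPreconnected_connectedComponentIn

lemma nonempty (R : Region A) : R.1.Nonempty := by
  obtain ⟨_, p, hp, rfl⟩ := R
  exact ⟨p, mem_connectedComponentIn hp⟩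

/-- The region of a point that lies on no curve. -/
def of (p : ℝ × ℝ) (hp : p ∈ (⋃₀ A)ᶜ) : Region A :=
  ⟨connectedComponentIn (⋃₀ A)ᶜ p, p, hp, rfl⟩

lemma mem_of (p : ℝ × ℝ) (hp : p ∈ (⋃₀ A)ᶜ) : p ∈ (of p hp).1 := mem_connectedComponentIn hp

lemma subset_of_meets (R : Region A) {S : Set (ℝ × ℝ)} (hS : IsPreconnected S)
    (hSA : S ⊆ (⋃₀ A)ᶜ) {p : ℝ × ℝ} (hpS : p ∈ S) (hpR : p ∈ R.1) : S ⊆ R.1 := by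
  obtain ⟨_, q, hq, rfl⟩ := R
  have := hS.subset_connectedComponentIn hpS hSA
  rwa [← connectedComponentIn_eq hpR] at this

lemma eq_of_mem {R S : Region A} {p : ℝ × ℝ} (hR : p ∈ R.1) (hS : p ∈ S.1) : R = S :=
  Subtype.ext (Subset.antisymm (S.subset_of_meets R.isPreconnected R.subset_compl hR hS)
    (R.subset_of_meets S.isPreconnected S.subset_compl hS hR))

lemma isOpen (hF : IsGraphFamily A F) (hA : A.Finite) (R : Region A) : IsOpen R.1 := by
  obtain ⟨_, p, hp, rfl⟩ := R
  exact (hF.isOpen_compl hA).connectedComponentIn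

/-- By connectedness no curve can be above one point of a region and below another, so a single
point decides the count. -/
lemma curvesAbove_eq (hF : IsGraphFamily A F) (R : Region A) {p : ℝ × ℝ} (hp : p ∈ R.1) :
    curvesAbove A R = (curvesOver A F p).ncard := by
  unfold curvesAbove curvesOver
  congr 1
  ext C
  simp only [mem_ofPred_eq, and_congr_right_iff]
  intro hC
  constructor
  · intro h
    obtain ⟨q, hq, hq1, hq2⟩ := h p hp
    rw [(hF C hC).2, hq1] at hq
    rwa [← hq]
  · intro h q hq
    refine ⟨(q.1, F C q.1), ((hF C hC).2 _).2 rfl, rfl, ?_⟩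
    exact lt_of_isPreconnected (hF C hC).1 R.isPreconnected
      (fun r hr => hF.mem_compl_iff.1 (R.subset_compl hr) C hC) hp hq h

end Region

/-- A vertical segment that meets no curve stays in one region. -/
lemma Region.eq_of_vertical (hF : IsGraphFamily A F) {R S : Region A} {x a b : ℝ} (hab : a ≤ b)
    (hR : (x, a) ∈ R.1) (hS : (x, b) ∈ S.1) (h : ∀ C ∈ A, a < F C x → b < F C x) : R = S := by
  have hconn : IsPreconnected ((fun y => (x, y)) '' Icc a b) :=
    isPreconnected_Icc.image _ (by fun_prop)
  refine Region.eq_of_mem (p := (x, b)) ?_ hS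
  refine R.subset_of_meets hconn ?_ ⟨a, ⟨le_rfl, hab⟩, rfl⟩ hR ⟨b, ⟨hab, le_rfl⟩, rfl⟩
  rintro _ ⟨y, ⟨hay, hyb⟩, rfl⟩
  rw [hF.mem_compl_iff]
  rintro C hC (rfl : y = F C x)
  rcases hay.lt_or_eq with h1 | h1
  · exact absurd (h C hC h1) (not_lt.2 hyb)
  · exact hF.mem_compl_iff.1 (R.subset_compl hR) C hC h1

/-- Two regions in the same layer over a common abscissa coincide. -/
lemma Region.eq_of_curvesAbove_eq (hF : IsGraphFamily A F) (hA : A.Finite) {R S : Region A}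
    (h : curvesAbove A R = curvesAbove A S)
    (hmeet : (Prod.fst '' R.1 ∩ Prod.fst '' S.1).Nonempty) : R = S := by
  obtain ⟨_, ⟨⟨x, a⟩, ha, rfl⟩, ⟨⟨y, b⟩, hb, hxy⟩⟩ := hmeet
  obtain rfl : y = x := hxy
  rw [R.curvesAbove_eq hF ha, S.curvesAbove_eq hF hb] at h
  have key : ∀ a b : ℝ, a ≤ b →
      (curvesOver A F (y, a)).ncard = (curvesOver A F (y, b)).ncard →
      ∀ C ∈ A, a < F C y → b < F C y := by
    intro a b hab h C hC hlt
    -- The sets of curves over the two points are nested, so equal finite cardinality forces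
    -- equality.
    have hsub : curvesOver A F (y, b) ⊆ curvesOver A F (y, a) :=
      fun D hD => ⟨hD.1, hab.trans_lt hD.2⟩
    have heq := eq_of_subset_of_ncard_le hsub h.le (hA.subset fun _ hD => hD.1)
    have : C ∈ curvesOver A F (y, b) := heq ▸ ⟨hC, hlt⟩
    exact this.2
  rcases le_total a b with hab | hab
  · exact Region.eq_of_vertical hF hab ha hb (key a b hab h)
  · exact (Region.eq_of_vertical hF hab hb ha (key b a hab h.symm)).symm

/-! ### The neighbourhood of a point on a single curve -/

/-- The points at horizontal distance less than `δ` from `x` whose height above the graph of `f`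
lies in `J`. -/
def strip (f : ℝ → ℝ) (x δ : ℝ) (J : Set ℝ) : Set (ℝ × ℝ) :=
  {p | p.1 ∈ Ioo (x - δ) (x + δ) ∧ p.2 - f p.1 ∈ J}

lemma isPreconnected_strip {f : ℝ → ℝ} (hf : Continuous f) (x δ : ℝ) {J : Set ℝ}
    (hJ : IsPreconnected J) : IsPreconnected (strip f x δ J) := by
  have : strip f x δ J = (fun p : ℝ × ℝ => (p.1, f p.1 + p.2)) '' (Ioo (x - δ) (x + δ) ×ˢ J) := by
    ext p
    constructor
    · rintro ⟨h1, h2⟩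
      exact ⟨(p.1, p.2 - f p.1), ⟨h1, h2⟩, by simp⟩
    · rintro ⟨q, ⟨h1, h2⟩, rfl⟩
      exact ⟨h1, by simpa using h2⟩
  rw [this]
  exact (isPreconnected_Ioo.prod hJ).image _ (by fun_prop)

lemma isOpen_strip {f : ℝ → ℝ} (hf : Continuous f) (x δ : ℝ) {J : Set ℝ}
    (hJ : IsOpen J) : IsOpen (strip f x δ J) :=
  (isOpen_Ioo.preimage continuous_fst).inter
    (hJ.preimage (continuous_snd.sub (hf.comp continuous_fst)))

/-- Near a point of `C` on no other curve, a thin strip around `C` misses all other curves. -/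
lemma exists_strip (hF : IsGraphFamily A F) (hA : A.Finite) {C : Set (ℝ × ℝ)} (hC : C ∈ A) {x : ℝ}
    (hx : ∀ D ∈ A, D ≠ C → F D x ≠ F C x) :
    ∃ δ > 0, ∃ ε > 0, ∀ D ∈ A, D ≠ C → ∀ y ∈ Ioo (x - δ) (x + δ), ε ≤ |F D y - F C y| := by
  have h1 : ∀ᶠ ε in 𝓝[>] (0 : ℝ), ∀ D ∈ A, D ≠ C → ε < |F D x - F C x| := by
    rw [Filter.eventually_all_finite hA]
    intro D hD
    by_cases hDC : D = C
    · simp [hDC]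
    · have : 0 < |F D x - F C x| := abs_pos.2 (sub_ne_zero.2 (hx D hD hDC))
      filter_upwards [Ioo_mem_nhdsGT this] with ε hε _ using hε.2
  obtain ⟨ε, hε, hε0⟩ := (h1.and self_mem_nhdsWithin).exists
  have h2 : ∀ᶠ y in 𝓝 x, ∀ D ∈ A, D ≠ C → ε < |F D y - F C y| := by
    rw [Filter.eventually_all_finite hA]
    intro D hD
    by_cases hDC : D = C
    · simp [hDC]
    · have hcont : Continuous fun y => |F D y - F C y| := ((hF D hD).1.sub (hF C hC).1).abs
      filter_upwards [hcont.continuousAt.eventually (lt_mem_nhds (hε D hD hDC))] with y hy _ using hy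
  obtain ⟨δ, hδ, hball⟩ := Metric.eventually_nhds_iff_ball.1 h2
  refine ⟨δ, hδ, ε, hε0, fun D hD hDC y hy => (hball y ?_ D hD hDC).le⟩
  rwa [Real.ball_eq_Ioo]

/-- The two open halves of such a strip lie off the curves. -/
lemma strip_subset_compl (hF : IsGraphFamily A F) {C : Set (ℝ × ℝ)} {x δ ε : ℝ}
    (h : ∀ D ∈ A, D ≠ C → ∀ y ∈ Ioo (x - δ) (x + δ), ε ≤ |F D y - F C y|) {J : Set ℝ}
    (hJ : ∀ t ∈ J, t ≠ 0 ∧ |t| < ε) : strip (F C) x δ J ⊆ (⋃₀ A)ᶜ := by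
  rintro p ⟨hp1, hp2⟩
  obtain ⟨h0, hε⟩ := hJ _ hp2
  rw [hF.mem_compl_iff]
  intro D hD heq
  by_cases hDC : D = C
  · subst hDC
    exact h0 (by rw [heq, sub_self])
  · have := h D hD hDC _ hp1
    rw [← heq] at this
    linarith

lemma mem_closure_strip (f : ℝ → ℝ) {x δ : ℝ} {J : Set ℝ} (hJ : (0 : ℝ) ∈ closure J) {p : ℝ × ℝ}
    (hp : p.1 ∈ Ioo (x - δ) (x + δ)) (hpf : p.2 = f p.1) : p ∈ closure (strip f x δ J) := by
  have hcont : Continuous fun t : ℝ => (p.1, f p.1 + t) := by fun_prop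
  have hmaps : MapsTo (fun t : ℝ => (p.1, f p.1 + t)) J (strip f x δ J) :=
    fun t ht => ⟨hp, by simpa using ht⟩
  have := hmaps.closure hcont hJ
  simpa [← hpf] using this

/-- A region that accumulates at a point of a single curve contains the upper or the lower half
of the strip around the curve. -/
lemma Region.strip_subset (hF : IsGraphFamily A F) {C : Set (ℝ × ℝ)} (hC : C ∈ A) {x δ ε : ℝ}
    (hδ : 0 < δ) (hε : 0 < ε)
    (h : ∀ D ∈ A, D ≠ C → ∀ y ∈ Ioo (x - δ) (x + δ), ε ≤ |F D y - F C y|) {R : Region A}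
    (hR : (x, F C x) ∈ closure R.1) :
    strip (F C) x δ (Ioo 0 ε) ⊆ R.1 ∨ strip (F C) x δ (Ioo (-ε) 0) ⊆ R.1 := by
  obtain ⟨p, ⟨hp1, hp2⟩, hpR⟩ := mem_closure_iff.1 hR _
    (isOpen_strip (hF C hC).1 x δ (isOpen_Ioo (a := -ε) (b := ε)))
    ⟨by simp [hδ], by simp [hε]⟩
  have hne : p.2 - F C p.1 ≠ 0 :=
    sub_ne_zero.2 (hF.mem_compl_iff.1 (R.subset_compl hpR) C hC)
  rcases hne.lt_or_gt with h0 | h0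
  · right
    refine R.subset_of_meets (isPreconnected_strip (hF C hC).1 x δ isPreconnected_Ioo)
      (strip_subset_compl hF h ?_) (p := p) ⟨hp1, hp2.1, h0⟩ hpR
    exact fun t ht => ⟨ht.2.ne, abs_lt.2 ⟨ht.1, ht.2.trans hε⟩⟩
  · left
    refine R.subset_of_meets (isPreconnected_strip (hF C hC).1 x δ isPreconnected_Ioo)
      (strip_subset_compl hF h ?_) (p := p) ⟨hp1, h0, hp2.2⟩ hpR
    exact fun t ht => ⟨ht.1.ne', abs_lt.2 ⟨by linarith [ht.1], ht.2⟩⟩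

/-- A point on a single curve, with the curve and the separation from the others. -/
lemma exists_of_mem_diff (hF : IsGraphFamily A F) {p : ℝ × ℝ}
    (hp : p ∈ ⋃₀ A \ crossingPoints A) :
    ∃ C ∈ A, p = (p.1, F C p.1) ∧ ∀ D ∈ A, D ≠ C → F D p.1 ≠ F C p.1 := by
  obtain ⟨⟨C, hC, hpC⟩, hcr⟩ := hp
  have h := ((hF C hC).2 p).1 hpC
  refine ⟨C, hC, Prod.ext rfl h, fun D hD hDC heq => hcr ⟨D, hD, C, hC, hDC, ?_, hpC⟩⟩
  rw [(hF D hD).2, heq, h]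

/-- An edge that meets the closure of a region is contained in it. -/
lemma Region.subset_closure (hF : IsGraphFamily A F) (hA : A.Finite) (R : Region A)
    {E : Set (ℝ × ℝ)} (hE : IsPreconnected E) (hEA : E ⊆ ⋃₀ A \ crossingPoints A)
    (hmeet : (E ∩ closure R.1).Nonempty) : E ⊆ closure R.1 := by
  -- This makes `closure R.1` relatively open in `E`: a half strip inside the region accumulates at
  -- every point of the curve within the strip. As it is also relatively closed, connectedness of
  -- `E` finishes.
  have hlocal : ∀ p ∈ E, p ∈ closure R.1 → p ∈ interior (closure R.1 ∪ (⋃₀ A)ᶜ) := by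
    intro p hpE hpR
    obtain ⟨C, hC, hpC, hsep⟩ := exists_of_mem_diff hF (hEA hpE)
    obtain ⟨δ, hδ, ε, hε, h⟩ := exists_strip hF hA hC hsep
    rw [mem_interior]
    refine ⟨strip (F C) p.1 δ (Ioo (-ε) ε), ?_, isOpen_strip (hF C hC).1 _ _ isOpen_Ioo,
      by simp [hδ], by rw [hpC]; simp [hε]⟩
    rintro q ⟨hq1, hq2⟩
    by_cases hqC : q.2 = F C q.1
    · left
      rw [hpC] at hpR
      rcases Region.strip_subset hF hC hδ hε h hpR with hsub | hsub
      · exact closure_mono hsub (mem_closure_strip _ (by simp [closure_Ioo hε.ne, hε.le]) hq1 hqC)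
      · exact closure_mono hsub (mem_closure_strip _
          (by rw [closure_Ioo (by linarith)]; simp [hε.le]) hq1 hqC)
    · right
      refine strip_subset_compl hF h (J := Ioo (-ε) ε \ {0}) ?_
        ⟨hq1, hq2, by simpa [sub_eq_zero] using hqC⟩
      exact fun t ht => ⟨ht.2, abs_lt.2 ht.1⟩
  by_contra hsub
  obtain ⟨q, hqE, hqR⟩ := not_subset.1 hsub
  obtain ⟨p, hpE, hpR⟩ := hmeet
  obtain ⟨r, hrE, hr1, hr2⟩ := hE _ _ isOpen_interior isClosed_closure.isOpen_compl
    (fun r hrE => (em (r ∈ closure R.1)).imp (hlocal r hrE) id)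
    ⟨p, hpE, hlocal p hpE hpR⟩ ⟨q, hqE, hqR⟩
  exact (interior_subset hr1).elim hr2 fun h => h (hEA hrE).1

/-- The frontier of a region is its closure without the region. -/
lemma Region.subset_frontier (hF : IsGraphFamily A F) (hA : A.Finite) (R : Region A)
    {E : Set (ℝ × ℝ)} (hEA : E ⊆ ⋃₀ A) (h : E ⊆ closure R.1) : E ⊆ frontier R.1 := by
  rw [(R.isOpen hF hA).frontier_eq]
  exact fun p hp => ⟨h hp, fun hpR => R.subset_compl hpR (hEA hp)⟩

/-! ### Crossing an edge -/

/-- Regions on the two sides of a curve at a point on no other curve are in consecutive layers. -/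
lemma curvesAbove_eq_add_one (hF : IsGraphFamily A F) (hA : A.Finite) {C : Set (ℝ × ℝ)}
    (hC : C ∈ A) {x a b : ℝ} {R S : Region A} (hR : (x, a) ∈ R.1) (hS : (x, b) ∈ S.1)
    (hb : b < F C x) (ha : F C x < a) (h : ∀ D ∈ A, D ≠ C → (b < F D x ↔ a < F D x)) :
    curvesAbove A S = curvesAbove A R + 1 := by
  rw [R.curvesAbove_eq hF hR, S.curvesAbove_eq hF hS]
  have hnot : C ∉ curvesOver A F (x, a) := fun h' => lt_asymm h'.2 ha
  rw [← ncard_insert_of_notMem hnot (hA.subset fun _ hD => hD.1)]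
  congr 1
  ext D
  rw [mem_insert_iff]
  by_cases hDC : D = C
  · subst hDC
    simp [curvesOver, hC, hb]
  · simp only [hDC, false_or]
    exact and_congr_right fun hD => h D hD hDC

/-- Used with `a` and `y` the heights of two curves over one abscissa: moving by less than `ε` off
the first never passes the second. -/
lemma lt_iff_lt_of_abs {a y ε s t : ℝ} (h : ε ≤ |y - a|) (hs : |s| < ε) (ht : |t| < ε) :
    a + s < y ↔ a + t < y := by
  rw [abs_lt] at hs ht
  rcases le_abs.1 h with h | h
  · exact ⟨fun _ => by linarith, fun _ => by linarith⟩
  · exact ⟨fun _ => by linarith, fun _ => by linarith⟩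

/-- Adjacent regions are in consecutive layers, over a common abscissa. -/
lemma dualGraph_adj (hF : IsGraphFamily A F) (hA : A.Finite) {R S : Region A}
    (hRS : (dualGraph A).Adj R S) :
    (curvesAbove A S = curvesAbove A R + 1 ∨ curvesAbove A R = curvesAbove A S + 1) ∧
      (Prod.fst '' R.1 ∩ Prod.fst '' S.1).Nonempty := by
  obtain ⟨hne, E, ⟨p, hp, rfl⟩, hER, hES⟩ := hRS
  have hpE := mem_connectedComponentIn hp
  have hpR := frontier_subset_closure (hER hpE)
  have hpS := frontier_subset_closure (hES hpE)
  obtain ⟨C, hC, hpC, hsep⟩ := exists_of_mem_diff hF hp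
  obtain ⟨δ, hδ, ε, hε, h⟩ := exists_strip hF hA hC hsep
  have hx : p.1 ∈ Ioo (p.1 - δ) (p.1 + δ) := by simp [hδ]
  rw [hpC] at hpR hpS
  have hup : (p.1, F C p.1 + ε / 2) ∈ strip (F C) p.1 δ (Ioo 0 ε) :=
    ⟨hx, by constructor <;> simp <;> linarith⟩
  have hdown : (p.1, F C p.1 + -(ε / 2)) ∈ strip (F C) p.1 δ (Ioo (-ε) 0) :=
    ⟨hx, by constructor <;> simp <;> linarith⟩
  have hsides : ∀ R S : Region A, strip (F C) p.1 δ (Ioo 0 ε) ⊆ R.1 →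
      strip (F C) p.1 δ (Ioo (-ε) 0) ⊆ S.1 → curvesAbove A S = curvesAbove A R + 1 := by
    intro R S hR hS
    refine curvesAbove_eq_add_one hF hA hC (hR hup) (hS hdown) (by linarith) (by linarith) ?_
    intro D hD hDC
    exact lt_iff_lt_of_abs (h D hD hDC _ hx) (by rw [abs_neg, abs_of_pos] <;> linarith)
      (by rw [abs_of_pos] <;> linarith)
  rcases Region.strip_subset hF hC hδ hε h hpR with hR | hR <;>
    rcases Region.strip_subset hF hC hδ hε h hpS with hS | hS
  · exact absurd (Region.eq_of_mem (hR hup) (hS hup)) hne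
  · exact ⟨.inl (hsides R S hR hS), p.1, ⟨_, hR hup, rfl⟩, ⟨_, hS hdown, rfl⟩⟩
  · exact ⟨.inr (hsides S R hS hR), p.1, ⟨_, hR hdown, rfl⟩, ⟨_, hS hup, rfl⟩⟩
  · exact absurd (Region.eq_of_mem (hR hdown) (hS hdown)) hne

/-- The abscissas of the crossing points form a finite set. -/
lemma finite_image_crossingPoints (hA : A.Finite)
    (hcross : ∀ C ∈ A, ∀ D ∈ A, C ≠ D → (C ∩ D).Finite) :
    (Prod.fst '' crossingPoints A).Finite := by
  have : crossingPoints A ⊆ ⋃ C ∈ A, ⋃ D ∈ A, ⋃ _ : C ≠ D, C ∩ D := by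
    rintro p ⟨C, hC, D, hD, hne, hpC, hpD⟩
    simp only [mem_iUnion]
    exact ⟨C, hC, D, hD, hne, hpC, hpD⟩
  refine ((hA.biUnion fun C hC => hA.biUnion fun D hD => ?_).subset this).image _
  exact finite_iUnion fun hne => hcross C hC D hD hne

/-- A region below some curve has a neighbour in the previous layer. -/
lemma exists_adj_of_curvesAbove_pos (hF : IsGraphFamily A F) (hA : A.Finite)
    (hcross : ∀ C ∈ A, ∀ D ∈ A, C ≠ D → (C ∩ D).Finite) (S : Region A)
    (hS : 0 < curvesAbove A S) :
    ∃ R, (dualGraph A).Adj R S ∧ curvesAbove A S = curvesAbove A R + 1 := by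
  -- The projection of an open region is open, hence infinite, and so avoids the finitely many
  -- abscissas of crossings.
  obtain ⟨⟨x, b⟩, hq, hx⟩ : ∃ q ∈ S.1, q.1 ∉ Prod.fst '' crossingPoints A := by
    have hopen : IsOpen (Prod.fst '' S.1) := isOpenMap_fst _ (S.isOpen hF hA)
    obtain ⟨y, hy⟩ := S.nonempty.image Prod.fst
    obtain ⟨_, ⟨q, hq, rfl⟩, hx⟩ := (infinite_of_mem_nhds y (hopen.mem_nhds hy)).exists_notMem_finite
      (finite_image_crossingPoints hA hcross)
    exact ⟨q, hq, hx⟩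
  rw [S.curvesAbove_eq hF hq] at hS
  have hfin : (curvesOver A F (x, b)).Finite := hA.subset fun _ hD => hD.1
  -- The lowest curve above the chosen point: `S` reaches up to it, and the neighbour `R` is found
  -- just beyond it.
  obtain ⟨C, ⟨hC, hbC : b < F C x⟩, hmin⟩ :=
    exists_min_image _ (fun C => F C x) hfin ((ncard_pos hfin).1 hS)
  have hmem : ∀ D ∈ A, (x, F D x) ∈ D := fun D hD => ((hF D hD).2 _).2 rfl
  have hsep : ∀ D ∈ A, D ≠ C → F D x ≠ F C x := fun D hD hDC heq =>
    hx ⟨(x, F C x), ⟨D, hD, C, hC, hDC, heq ▸ hmem D hD, hmem C hC⟩, rfl⟩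
  have hp : (x, F C x) ∈ ⋃₀ A \ crossingPoints A :=
    ⟨⟨C, hC, hmem C hC⟩, fun h => hx ⟨_, h, rfl⟩⟩
  obtain ⟨δ, hδ, ε, hε, h⟩ := exists_strip hF hA hC hsep
  have hx' : x ∈ Ioo (x - δ) (x + δ) := by simp [hδ]
  have hlow : Ico b (F C x) ⊆ {y | (x, y) ∈ S.1} := by
    rintro y ⟨hby, hyC⟩
    have hyA : (x, y) ∈ (⋃₀ A)ᶜ := by
      rw [hF.mem_compl_iff]
      rintro D hD (rfl : y = F D x)
      rcases hby.lt_or_eq with hlt | heq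
      · exact absurd (hmin D ⟨hD, hlt⟩) (not_le.2 hyC)
      · exact hF.mem_compl_iff.1 (S.subset_compl hq) D hD heq
    have hSy : S = Region.of _ hyA :=
      Region.eq_of_vertical hF hby hq (Region.mem_of _ _) fun D hD hbD =>
        hyC.trans_le (hmin D ⟨hD, hbD⟩)
    exact hSy ▸ Region.mem_of _ hyA
  have hup : (x, F C x + ε / 2) ∈ strip (F C) x δ (Ioo 0 ε) :=
    ⟨hx', by constructor <;> simp <;> linarith⟩
  have hstrip : strip (F C) x δ (Ioo 0 ε) ⊆ (⋃₀ A)ᶜ := strip_subset_compl hF h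
    fun t ht => ⟨ht.1.ne', abs_lt.2 ⟨by linarith [ht.1], ht.2⟩⟩
  set R : Region A := Region.of _ (hstrip hup) with hRdef
  have hRup : strip (F C) x δ (Ioo 0 ε) ⊆ R.1 :=
    R.subset_of_meets (isPreconnected_strip (hF C hC).1 x δ isPreconnected_Ioo) hstrip hup
      (Region.mem_of _ _)
  have hclR : (x, F C x) ∈ closure R.1 := closure_mono hRup
    (mem_closure_strip _ (by simp [closure_Ioo hε.ne, hε.le]) hx' rfl)
  have hclS : (x, F C x) ∈ closure S.1 := by
    have hmaps : MapsTo (fun y : ℝ => (x, y)) (Ico b (F C x)) S.1 := fun y hy => hlow hy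
    exact hmaps.closure (by fun_prop)
      (by rw [closure_Ico hbC.ne]; exact right_mem_Icc.2 hbC.le)
  have hlevel : curvesAbove A S = curvesAbove A R + 1 := by
    refine curvesAbove_eq_add_one hF hA hC (hRup hup) hq hbC (by linarith) fun D hD hDC => ?_
    have habs := h D hD hDC x hx'
    constructor
    · intro hbD
      have := hmin D ⟨hD, hbD⟩
      rw [abs_of_nonneg (by linarith)] at habs
      linarith
    · intro hlt
      linarith
  have hconn : IsPreconnected (connectedComponentIn (⋃₀ A \ crossingPoints A) (x, F C x)) :=
    isPreconnected_connectedComponentIn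
  have hsub := connectedComponentIn_subset (⋃₀ A \ crossingPoints A) (x, F C x)
  have hpE := mem_connectedComponentIn hp
  -- Both closures contain one point of the edge, so by `Region.subset_closure` they contain all of
  -- it.
  refine ⟨R, ⟨?_, _, ⟨_, hp, rfl⟩, ?_, ?_⟩, hlevel⟩
  · intro heq
    rw [heq] at hlevel
    omega
  · exact R.subset_frontier hF hA (hsub.trans sdiff_subset)
      (R.subset_closure hF hA hconn hsub ⟨_, hpE, hclR⟩)
  · exact S.subset_frontier hF hA (hsub.trans sdiff_subset)
      (S.subset_closure hF hA hconn hsub ⟨_, hpE, hclS⟩)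

/-! ### The topmost region -/

lemma mem_aboveAll_iff (hF : IsGraphFamily A F) {p : ℝ × ℝ} :
    p ∈ aboveAll A ↔ ∀ C ∈ A, F C p.1 < p.2 := by
  refine forall₂_congr fun C hC => ⟨fun h => ?_, fun h q hq hqp => ?_⟩
  · exact h (p.1, F C p.1) (((hF C hC).2 _).2 rfl) rfl
  · rwa [((hF C hC).2 q).1 hq, hqp]

/-- The part of the plane above all curves is connected. -/
lemma isPreconnected_aboveAll (hF : IsGraphFamily A F) (hA : A.Finite) :
    IsPreconnected (aboveAll A) := by
  -- The graph of `g` is a connected spine above all curves, to which every point of the set is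
  -- joined vertically. The summand 1 makes the bound strict.
  obtain ⟨g, hg, hgA⟩ : ∃ g : ℝ → ℝ, Continuous g ∧ ∀ x, ∀ C ∈ A, F C x < g x := by
    refine ⟨fun x => (∑ C ∈ hA.toFinset, |F C x|) + 1, ?_, fun x C hC => ?_⟩
    · refine (continuous_finsetSum _ fun C hC => ?_).add continuous_const
      exact (hF C (hA.mem_toFinset.1 hC)).1.abs
    · have := Finset.single_le_sum (f := fun C => |F C x|) (fun C _ => abs_nonneg _)
        (hA.mem_toFinset.2 hC)
      have := le_abs_self (F C x)
      dsimp only at *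
      linarith
  have hgraph : IsPreconnected (range fun x => (x, g x)) :=
    isPreconnected_range (by fun_prop)
  refine isPreconnected_of_forall (0, g 0) fun p hp => ?_
  rw [mem_aboveAll_iff hF] at hp
  refine ⟨(range fun x => (x, g x)) ∪ (fun y => (p.1, y)) '' uIcc p.2 (g p.1), ?_,
    .inl ⟨0, rfl⟩, .inr ⟨p.2, left_mem_uIcc, rfl⟩, ?_⟩
  · rintro _ (⟨x, rfl⟩ | ⟨y, hy, rfl⟩)
    · exact (mem_aboveAll_iff hF).2 (hgA x)
    · exact (mem_aboveAll_iff hF).2 fun C hC => (lt_min (hp C hC) (hgA _ C hC)).trans_le hy.1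
  · exact hgraph.union (p.1, g p.1) ⟨_, rfl⟩ ⟨_, right_mem_uIcc, rfl⟩
      (isPreconnected_uIcc.image _ (by fun_prop))

/-- Every vertical line has a point above all curves. -/
lemma exists_mem_aboveAll (hF : IsGraphFamily A F) (hA : A.Finite) (x : ℝ) :
    ∃ y, (x, y) ∈ aboveAll A := by
  obtain ⟨b, hb⟩ := (hA.image fun C => F C x).bddAbove
  refine ⟨b + 1, (mem_aboveAll_iff hF).2 fun C hC => ?_⟩
  have : F C x ≤ b := hb ⟨C, hC, rfl⟩
  show F C x < b + 1
  linarith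

/-- The part of the plane above all curves is a region. -/
lemma exists_region_eq_aboveAll (hF : IsGraphFamily A F) (hA : A.Finite) :
    ∃ T : Region A, T.1 = aboveAll A := by
  obtain ⟨y, hy⟩ := exists_mem_aboveAll hF hA 0
  have hsub : aboveAll A ⊆ (⋃₀ A)ᶜ := fun p hp =>
    hF.mem_compl_iff.2 fun C hC => ((mem_aboveAll_iff hF).1 hp C hC).ne'
  let T := Region.of _ (hsub hy)
  have hT : (0, y) ∈ T.1 := Region.mem_of _ _
  refine ⟨T, Subset.antisymm (fun p hp => (mem_aboveAll_iff hF).2 fun C hC => ?_)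
    (T.subset_of_meets (isPreconnected_aboveAll hF hA) hsub hy hT)⟩
  have hne := hF.mem_compl_iff.1 (T.subset_compl hp) C hC
  refine lt_of_le_of_ne (not_lt.1 fun hlt => ?_) hne.symm
  have := lt_of_isPreconnected (hF C hC).1 T.isPreconnected
    (fun r hr => hF.mem_compl_iff.1 (T.subset_compl hr) C hC) hp hT hlt
  exact lt_asymm this ((mem_aboveAll_iff hF).1 hy C hC)

lemma curvesAbove_eq_zero (hF : IsGraphFamily A F) {T : Region A} (hT : T.1 = aboveAll A) :
    curvesAbove A T = 0 := by
  obtain ⟨p, hp⟩ := T.nonempty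
  rw [T.curvesAbove_eq hF hp]
  have : curvesOver A F p = ∅ := eq_empty_of_forall_notMem fun C hC =>
    lt_asymm hC.2 ((mem_aboveAll_iff hF).1 (hT ▸ hp) C hC.1)
  rw [this, ncard_empty]

/-- The topmost region lies over every abscissa, so it shares one with any other region of layer
zero. -/
lemma eq_of_curvesAbove_eq_zero (hF : IsGraphFamily A F) (hA : A.Finite) {T R : Region A}
    (hT : T.1 = aboveAll A) (hR : curvesAbove A R = 0) : R = T := by
  refine Region.eq_of_curvesAbove_eq hF hA (hR.trans (curvesAbove_eq_zero hF hT).symm) ?_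
  obtain ⟨p, hp⟩ := R.nonempty
  obtain ⟨y, hy⟩ := exists_mem_aboveAll hF hA p.1
  exact ⟨p.1, ⟨p, hp, rfl⟩, ⟨(p.1, y), hT ▸ hy, rfl⟩⟩

end Arrangement

end MonotoneArrangement

theorem mainTheorem12 (A : Set (Set (ℝ × ℝ))) (hfinite : A.Finite)
    (hmono : ∀ C ∈ A, MonotoneArrangement.IsXMonotoneCurve C)
    (hcover : ∀ C ∈ A, Prod.fst '' C = Set.univ)
    (hcross : ∀ C ∈ A, ∀ D ∈ A, C ≠ D → (C ∩ D).Finite) :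
    ∃ top : MonotoneArrangement.Region A,
      top.1 = MonotoneArrangement.aboveAll A ∧
      MonotoneArrangement.IsBreadthFirstLayering (MonotoneArrangement.dualGraph A) top
        (MonotoneArrangement.curvesAbove A) ∧
      MonotoneArrangement.IsPlanarLayering (MonotoneArrangement.dualGraph A)
        (MonotoneArrangement.curvesAbove A) := by
  have hex : ∀ C, ∃ f : ℝ → ℝ, C ∈ A → Continuous f ∧ ∀ p, p ∈ C ↔ p.2 = f p.1 := by
    intro C
    by_cases hC : C ∈ A
    · obtain ⟨f, hf⟩ := (hmono C hC).exists_continuous (hcover C hC)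
      exact ⟨f, fun _ => hf⟩
    · exact ⟨0, fun h => absurd h hC⟩
  choose F hF using hex
  replace hF : MonotoneArrangement.IsGraphFamily A F := hF
  obtain ⟨T, hT⟩ := MonotoneArrangement.exists_region_eq_aboveAll hF hfinite
  refine ⟨T, hT, ?_, ?_⟩
  · refine MonotoneArrangement.isBreadthFirstLayering_of_step
      (MonotoneArrangement.curvesAbove_eq_zero hF hT)
      (fun R hR => MonotoneArrangement.eq_of_curvesAbove_eq_zero hF hfinite hT hR)
      (fun R S hRS => ?_)
      (MonotoneArrangement.exists_adj_of_curvesAbove_pos hF hfinite hcross)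
    rcases (MonotoneArrangement.dualGraph_adj hF hfinite hRS).1 with h | h <;> omega
  · choose p hp using fun R : MonotoneArrangement.Region A => R.nonempty
    exact MonotoneArrangement.isPlanarLayering_of_intervals (fun R => Prod.fst '' R.1)
      (fun R => (p R).1)
      (fun R => (R.isPreconnected.image _ continuous_fst.continuousOn).ordConnected)
      (fun R => ⟨p R, hp R, rfl⟩)
      (fun R S h hmeet => MonotoneArrangement.Region.eq_of_curvesAbove_eq hF hfinite h hmeet)
      (fun R S hRS => (MonotoneArrangement.dualGraph_adj hF hfinite hRS).1)
      (fun R S hRS => (MonotoneArrangement.dualGraph_adj hF hfinite hRS).2)
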